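/- Let $k \ge 1$ be an integer and let $G$ be a finite simple graph that is outer min-$k$-planar, that is, $G$ admits a drawing in which the vertices are placed on different points of a circle, the edges are drawn as straight-line segments, and, for every pair of crossing edges, at least one of the two edges is crossed by at most $k$ edges of $G$. (Two different edges cross if their segments share a point that is an interior point of both.) Then the treewidth of $G$ is at most $3k+1$, that is, $G$ has a tree decomposition all of whose bags contain at most $3k+2$ vertices. -/

import Mathlib

namespace ConvexGraphDrawing

/-- A tree decomposition of a graph `G`: a finite tree whose nodes carry bags of vertices such that
every vertex and every edge is covered by some bag and, for every vertex `v`, the nodes whose bags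
contain `v` induce a (connected) subtree. -/
structure TreeDecomposition {V : Type*} (G : SimpleGraph V) where
  Node : Type
  finite_node : Finite Node
  tree : SimpleGraph Node
  isTree : tree.IsTree
  bag : Node → Set V
  vertex_cover : ∀ v : V, ∃ i : Node, v ∈ bag i
  edge_cover : ∀ u v : V, G.Adj u v → ∃ i : Node, u ∈ bag i ∧ v ∈ bag i
  subtree : ∀ v : V, (tree.induce {i : Node | v ∈ bag i}).Connected

/-- The width: the maximum size of a bag, minus one. -/
noncomputable def TreeDecomposition.width {V : Type*} {G : SimpleGraph V}
    (D : TreeDecomposition G) : ℕ∞ :=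
  (⨆ i : D.Node, (D.bag i).encard) - 1

/-- The treewidth: the minimum width over all tree decompositions. -/
noncomputable def treewidth {V : Type*} (G : SimpleGraph V) : ℕ∞ :=
  ⨅ D : TreeDecomposition G, D.width

/-- The data of a convex drawing of a graph on `V`: the vertices are placed on different points of a
circle in the Euclidean plane. Edges are drawn as straight-line segments (see `edgeInterior`). -/
structure ConvexDrawing (V : Type*) where
  center : EuclideanSpace ℝ (Fin 2)
  radius : ℝ
  radius_pos : 0 < radius
  pos : V → EuclideanSpace ℝ (Fin 2)
  pos_injective : Function.Injective pos
  pos_mem : ∀ v : V, pos v ∈ Metric.sphere center radius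

/-- The straight-line segment that represents an edge, without its two endpoints. -/
def ConvexDrawing.edgeInterior {V : Type*} (Γ : ConvexDrawing V) :
    Sym2 V → Set (EuclideanSpace ℝ (Fin 2)) :=
  Sym2.lift ⟨fun u v => openSegment ℝ (Γ.pos u) (Γ.pos v),
    fun u v => openSegment_symm ℝ (Γ.pos u) (Γ.pos v)⟩

/-- Two edges cross if they are different and share an interior point. -/
def ConvexDrawing.Cross {V : Type*} (Γ : ConvexDrawing V) (e f : Sym2 V) : Prop :=
  e ≠ f ∧ (Γ.edgeInterior e ∩ Γ.edgeInterior f).Nonempty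

/-- The number of crossings of `e` with edges of `G`. -/
noncomputable def ConvexDrawing.crossings {V : Type*} (Γ : ConvexDrawing V) (G : SimpleGraph V)
    (e : Sym2 V) : ℕ∞ :=
  {f : Sym2 V | f ∈ G.edgeSet ∧ Γ.Cross e f}.encard

/-- `G` admits a convex drawing in which, for every pair of crossing edges, at least one of the two
has at most `k` crossings. -/
def IsOuterMinPlanar {V : Type*} (k : ℕ) (G : SimpleGraph V) : Prop :=
  ∃ Γ : ConvexDrawing V, ∀ e ∈ G.edgeSet, ∀ f ∈ G.edgeSet, Γ.Cross e f →
    Γ.crossings G e ≤ (k : ℕ∞) ∨ Γ.crossings G f ≤ (k : ℕ∞)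

end ConvexGraphDrawing

/-!
Order the vertices along the circle and put `m = 2k - 1`. A chord between two vertices, edge or not,
is good if at most `m` edges cross it. Starting from the chord between the first and the last
vertex, cut off triangles: behind every good chord `uv` with a vertex behind it there is a vertex
`t` for which `ut` and `tv` are good as well. For this take a median `x` of the ends behind `uv` of
the edges crossing `uv`, and let `xy` be such an edge, so that at most `m / 2` of these edges leave
on either side of `x`. If nothing crosses `uv`, put `y = u` and let `x` be the last neighbour of `u`
behind `uv`, or the vertex next to `u` if there is none. If `xy` has at most `k` crossings, `t = x`
works since `k + m / 2 ≤ m`. Otherwise every edge crossing `xy` has at most `k` crossings, and `t`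
can be taken to be an end of an outermost edge that separates `x` from `uv`, or `t = x` if there is
none.

Each good chord `uv` yields a tree decomposition of the part behind it, with a root bag formed by
`u`, `v` and the ends behind `uv` of the edges crossing `uv`. To glue the decompositions at the
sides of a triangle, the ends of the edges crossing two of its sides are exchanged one at a time.
At most `3m / 2` edges cross two sides, so all bags have at most `3 + 3m / 2 + 1 ≤ 3k + 2` vertices,
where the last bound uses that cardinalities are integers.
-/

namespace ConvexGraphDrawing

open Finset

section TreeSum

variable {M N : Type*} {S : SimpleGraph M} {T : SimpleGraph N}

lemma connected_induce_image (f : S →g T) {A : Set M} (hA : (S.induce A).Connected) :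
    (T.induce (f '' A)).Connected :=
  hA.map (SimpleGraph.induceHom f (Set.mapsTo_image f A)) <| by
    rintro ⟨_, x, hx, rfl⟩
    exact ⟨⟨x, hx⟩, rfl⟩

lemma not_isCycle_sum_inl (hS : S.IsAcyclic) {v : M}
    (p : (S ⊕g T).Walk (Sum.inl v) (Sum.inl v)) : ¬ p.IsCycle := by
  classical
  intro hp
  have hsupport : ∀ x ∈ p.support, x ∈ Set.range (Sum.inl : M → M ⊕ N) := by
    rintro (w | w) hw
    · exact ⟨w, rfl⟩
    · exact absurd ⟨p.takeUntil _ hw⟩ (SimpleGraph.not_reachable_sum_inl_inr v w)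
  have hrange : ((S ⊕g T).induce (Set.range Sum.inl)).IsAcyclic :=
    (SimpleGraph.Embedding.sumInl (G := S) (H := T)).isoInduceRange.isAcyclic_iff.1 hS
  refine hrange (p.induce _ hsupport)
    (SimpleGraph.Walk.IsCycle.of_map (f := (SimpleGraph.Embedding.induce _).toHom) ?_)
  rwa [SimpleGraph.Walk.map_induce]

lemma isAcyclic_sum (hS : S.IsAcyclic) (hT : T.IsAcyclic) : (S ⊕g T).IsAcyclic := by
  rintro (v | v) p hp
  · exact not_isCycle_sum_inl hS p hp
  · exact not_isCycle_sum_inl hT (p.map SimpleGraph.Iso.sumComm.toHom)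
      (hp.map SimpleGraph.Iso.sumComm.injective)

lemma isTree_sum_sup_edge (hS : S.IsTree) (hT : T.IsTree) (a : M) (b : N) :
    ((S ⊕g T) ⊔ SimpleGraph.edge (Sum.inl a) (Sum.inr b)).IsTree :=
  have hacyclic := isAcyclic_sum hS.isAcyclic hT.isAcyclic
  ⟨hS.connected.sum_sup_edge hT.connected,
    hacyclic.sup_edge_of_not_reachable (SimpleGraph.not_reachable_sum_inl_inr a b)⟩

end TreeSum

/-- The induced subgraph `G[S]` has a tree decomposition with bags of at most `n` vertices, one of
which, the root bag, contains `R`. The bags are sets of vertices of `G` rather than of `G[S]`, so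
that decompositions on overlapping vertex sets can be glued. -/
def HasRootedDecomp {V : Type*} (G : SimpleGraph V) (n : ℕ) (S R : Finset V) : Prop :=
  ∃ (Node : Type) (_ : Finite Node) (T : SimpleGraph Node) (bag : Node → Finset V) (r : Node),
    T.IsTree ∧ R ⊆ bag r ∧ (∀ i, bag i ⊆ S) ∧ (∀ i, #(bag i) ≤ n) ∧
    (∀ v ∈ S, (T.induce {i | v ∈ bag i}).Connected) ∧
    ∀ u ∈ S, ∀ v ∈ S, G.Adj u v → ∃ i, u ∈ bag i ∧ v ∈ bag i

namespace HasRootedDecomp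

variable {V : Type*} {G : SimpleGraph V} {n : ℕ} {S S₁ S₂ R R₁ R₂ : Finset V}

lemma root_subset (h : HasRootedDecomp G n S R) : R ⊆ S := by
  obtain ⟨_, _, _, bag, r, -, hr, hsub, -⟩ := h
  exact hr.trans (hsub r)

lemma mono_root (h : HasRootedDecomp G n S R₁) (hR : R₂ ⊆ R₁) : HasRootedDecomp G n S R₂ := by
  obtain ⟨Node, hfin, T, bag, r, hT, hr, hrest⟩ := h
  exact ⟨Node, hfin, T, bag, r, hT, hR.trans hr, hrest⟩

lemma of_card_le (hS : #S ≤ n) : HasRootedDecomp G n S S := by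
  refine ⟨PUnit, inferInstance, ⊥, fun _ => S, PUnit.unit, .of_subsingleton, subset_rfl,
    fun _ => subset_rfl, fun _ => hS, fun v hv => ?_, fun u hu v hv _ => ⟨PUnit.unit, hu, hv⟩⟩
  have : Nonempty {_i : PUnit | v ∈ S} := ⟨⟨PUnit.unit, hv⟩⟩
  exact SimpleGraph.IsTree.of_subsingleton.connected

lemma treewidth_le [Fintype V] (h : HasRootedDecomp G (n + 1) univ R) :
    treewidth G ≤ (n : ℕ∞) := by
  obtain ⟨Node, hfin, T, bag, -, hT, -, -, hcard, hconn, hedge⟩ := h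
  let D : TreeDecomposition G :=
    { Node := Node
      finite_node := hfin
      tree := T
      isTree := hT
      bag := fun i => bag i
      vertex_cover := fun v => (hconn v (mem_univ v)).nonempty.elim fun i => ⟨i.1, i.2⟩
      edge_cover := fun u v => hedge u (mem_univ u) v (mem_univ v)
      subtree := fun v => hconn v (mem_univ v) }
  refine (iInf_le _ D).trans (tsub_le_iff_right.2 (iSup_le fun i => ?_))
  rw [Set.encard_coe_eq_coe_finsetCard]
  exact_mod_cast hcard i

variable [DecidableEq V]

lemma join (h₁ : HasRootedDecomp G n S₁ R₁) (h₂ : HasRootedDecomp G n S₂ R₂)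
    (hR₁ : S₁ ∩ S₂ ⊆ R₁) (hR₂ : S₁ ∩ S₂ ⊆ R₂)
    (hsep : ∀ a ∈ S₁ \ S₂, ∀ b ∈ S₂ \ S₁, ¬ G.Adj a b) :
    HasRootedDecomp G n (S₁ ∪ S₂) R₁ := by
  obtain ⟨N₁, _, T₁, bag₁, r₁, hT₁, hr₁, hsub₁, hcard₁, hconn₁, hedge₁⟩ := h₁
  obtain ⟨N₂, _, T₂, bag₂, r₂, hT₂, hr₂, hsub₂, hcard₂, hconn₂, hedge₂⟩ := h₂
  let T := (T₁ ⊕g T₂) ⊔ SimpleGraph.edge (Sum.inl r₁) (Sum.inr r₂)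
  let ι₁ : T₁ →g T := (SimpleGraph.Hom.ofLE le_sup_left).comp SimpleGraph.Embedding.sumInl.toHom
  let ι₂ : T₂ →g T := (SimpleGraph.Hom.ofLE le_sup_left).comp SimpleGraph.Embedding.sumInr.toHom
  refine ⟨N₁ ⊕ N₂, inferInstance, T, Sum.elim bag₁ bag₂, Sum.inl r₁,
    isTree_sum_sup_edge hT₁ hT₂ r₁ r₂, hr₁, ?_, ?_, fun v hv => ?_, fun u hu v hv huv => ?_⟩
  · exact Sum.rec (fun i => (hsub₁ i).trans subset_union_left)
      (fun i => (hsub₂ i).trans subset_union_right)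
  · exact Sum.rec hcard₁ hcard₂
  · have hnodes : {i | v ∈ Sum.elim bag₁ bag₂ i} =
        ι₁ '' {i | v ∈ bag₁ i} ∪ ι₂ '' {i | v ∈ bag₂ i} := by
      ext (i | i) <;> simp [ι₁, ι₂]
    rw [hnodes]
    by_cases hv₁ : v ∈ S₁ <;> by_cases hv₂ : v ∈ S₂
    · have hv₁₂ : v ∈ S₁ ∩ S₂ := mem_inter.2 ⟨hv₁, hv₂⟩
      exact SimpleGraph.connected_induce_union
        (connected_induce_image ι₁ (hconn₁ v hv₁)).preconnected
        (connected_induce_image ι₂ (hconn₂ v hv₂)).preconnected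
        (Set.mem_image_of_mem ι₁ (hr₁ (hR₁ hv₁₂))) (Set.mem_image_of_mem ι₂ (hr₂ (hR₂ hv₁₂)))
        (by simp [T, ι₁, ι₂, SimpleGraph.edge_adj])
    · have hempty : {i | v ∈ bag₂ i} = ∅ :=
        Set.eq_empty_of_forall_notMem fun i hi => hv₂ (hsub₂ i hi)
      rw [hempty, Set.image_empty, Set.union_empty]
      exact connected_induce_image ι₁ (hconn₁ v hv₁)
    · have hempty : {i | v ∈ bag₁ i} = ∅ :=
        Set.eq_empty_of_forall_notMem fun i hi => hv₁ (hsub₁ i hi)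
      rw [hempty, Set.image_empty, Set.empty_union]
      exact connected_induce_image ι₂ (hconn₂ v hv₂)
    · exact absurd hv (by simp [hv₁, hv₂])
  · have hcases : (u ∈ S₁ ∧ v ∈ S₁) ∨ (u ∈ S₂ ∧ v ∈ S₂) := by
      have := hsep u
      have := hsep v
      grind [G.adj_comm u v]
    rcases hcases with ⟨hu, hv⟩ | ⟨hu, hv⟩
    · exact (hedge₁ u hu v hv huv).elim fun i hi => ⟨Sum.inl i, hi⟩
    · exact (hedge₂ u hu v hv huv).elim fun i hi => ⟨Sum.inr i, hi⟩

lemma introduce {B : Finset V} (h : HasRootedDecomp G n S R) (hB : #B ≤ n) (hBS : B ∩ S ⊆ R)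
    (hadj : ∀ b ∈ B \ S, ∀ s ∈ S, G.Adj b s → s ∈ B) : HasRootedDecomp G n (B ∪ S) B :=
  (of_card_le hB).join h inter_subset_left hBS fun b hb s hs hbs =>
    (mem_sdiff.1 hs).2 (hadj b hb s (mem_sdiff.1 hs).1 hbs)

end HasRootedDecomp

section Touching

variable {V : Type*} (G : SimpleGraph V) [DecidableRel G.Adj]

/-- The vertices of `A` that have a neighbour in `B`. -/
def touching (A B : Finset V) : Finset V :=
  {a ∈ A | ∃ b ∈ B, G.Adj a b}

variable {G} {A A₁ A₂ B B₁ B₂ : Finset V} {a : V}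

@[grind =]
lemma mem_touching : a ∈ touching G A B ↔ a ∈ A ∧ ∃ b ∈ B, G.Adj a b :=
  mem_filter

lemma touching_subset : touching G A B ⊆ A :=
  filter_subset _ _

lemma touching_mono (hA : A₁ ⊆ A₂) (hB : B₁ ⊆ B₂) : touching G A₁ B₁ ⊆ touching G A₂ B₂ :=
  fun a ha => by grind

lemma card_touching_le_card_interedges (A B : Finset V) :
    #(touching G A B) ≤ #(G.interedges A B) := by
  classical
  refine (card_le_card fun a ha => ?_).trans (card_image_le (f := Prod.fst))
  obtain ⟨haA, b, hb, hab⟩ := mem_touching.1 ha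
  exact mem_image.2 ⟨(a, b), G.mk_mem_interedges_iff.2 ⟨haA, hb, hab⟩, rfl⟩

lemma card_interedges_comm (A B : Finset V) : #(G.interedges A B) = #(G.interedges B A) :=
  have : Std.Symm G.Adj := ⟨fun _ _ h => h.symm⟩
  Rel.card_interedges_comm A B

lemma card_interedges_mono (hA : A₁ ⊆ A₂) (hB : B₁ ⊆ B₂) :
    #(G.interedges A₁ B₁) ≤ #(G.interedges A₂ B₂) :=
  card_le_card (G.interedges_mono hA hB)

variable [DecidableEq V]

lemma card_interedges_union_left (hA : Disjoint A₁ A₂) (B : Finset V) :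
    #(G.interedges (A₁ ∪ A₂) B) = #(G.interedges A₁ B) + #(G.interedges A₂ B) := by
  rw [← card_union_of_disjoint (G.interedges_disjoint_left hA B)]
  congr 1
  grind [SimpleGraph.mem_interedges_iff]

lemma card_interedges_union_right (A : Finset V) (hB : Disjoint B₁ B₂) :
    #(G.interedges A (B₁ ∪ B₂)) = #(G.interedges A B₁) + #(G.interedges A B₂) := by
  rw [← card_union_of_disjoint (G.interedges_disjoint_right A hB)]
  congr 1
  grind [SimpleGraph.mem_interedges_iff]

end Touching

namespace HasRootedDecomp

variable {V : Type*} [DecidableEq V] {G : SimpleGraph V} [DecidableRel G.Adj] {n : ℕ}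
  {S A B C O P X : Finset V}

/- The vertices of `X` enter the root bag one at a time; once `x` has entered, the vertices of `B`
whose only neighbour in the remaining part of `X` was `x` can leave. -/
lemma exchange (h : HasRootedDecomp G n S (C ∪ touching G B X))
    (hX : ∀ x ∈ X, ∃ b ∈ B, G.Adj x b) (hXS : Disjoint X S)
    (hadj : ∀ x ∈ X, ∀ s ∈ S, G.Adj x s → s ∈ C ∪ B)
    (hn : #C + #(G.interedges X B) + 1 ≤ n) :
    HasRootedDecomp G n (S ∪ X) (C ∪ X) := by
  induction X using Finset.induction generalizing C S with
  | empty => simpa using h.mono_root (R₂ := C) subset_union_left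
  | insert x X hx ih =>
    have hroot := h.root_subset
    have hpos : 0 < #(G.interedges {x} B) := by
      obtain ⟨b, hb, hxb⟩ := hX x (mem_insert_self x X)
      exact card_pos.2 ⟨(x, b), G.mk_mem_interedges_iff.2 ⟨mem_singleton_self x, hb, hxb⟩⟩
    have hcount : #(G.interedges (insert x X) B) = #(G.interedges {x} B) + #(G.interedges X B) :=
      card_interedges_union_left (disjoint_singleton_left.2 hx) B
    have hC := card_insert_le x C
    have hbag : #(insert x C ∪ touching G B (insert x X)) ≤ n := by
      have := card_union_le (insert x C) (touching G B (insert x X))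
      have := card_touching_le_card_interedges (G := G) B (insert x X)
      have := card_interedges_comm (G := G) B (insert x X)
      omega
    have hstep : HasRootedDecomp G n (insert x S) (insert x C ∪ touching G B X) := by
      have hnew : insert x C ∪ touching G B (insert x X) ∪ S = insert x S := by grind
      refine hnew ▸ (h.introduce hbag ?_ ?_).mono_root ?_
      · grind
      · grind [G.adj_comm]
      · exact union_subset_union_right (touching_mono subset_rfl (subset_insert x X))
    have hrest := ih hstep (fun y hy => hX y (mem_insert_of_mem hy)) (by grind) (by grind)
      (by omega)
    convert hrest using 1 <;> grind

lemma merge (hA : HasRootedDecomp G n (A ∪ P) (P ∪ touching G A (B ∪ O)))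
    (hB : HasRootedDecomp G n (B ∪ P) (P ∪ touching G B (A ∪ O)))
    (hAB : Disjoint A B) (hAP : Disjoint A P)
    (hn : #P + #(G.interedges A B) + #(G.interedges A O) + #(G.interedges B O) + 1 ≤ n) :
    HasRootedDecomp G n (A ∪ B ∪ P) (P ∪ touching G (A ∪ B) O) := by
  have hcardAB := card_touching_le_card_interedges (G := G) A B
  have hcardAO := card_touching_le_card_interedges (G := G) A O
  have hcardBO := card_touching_le_card_interedges (G := G) B O
  have hcardC := card_union_le P (touching G B O)
  have hexchanged : HasRootedDecomp G n (B ∪ P ∪ touching G A B)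
      (P ∪ touching G B O ∪ touching G A B) := by
    have hX : #(G.interedges (touching G A B) B) ≤ #(G.interedges A B) :=
      card_interedges_mono touching_subset subset_rfl
    have hroot : touching G B O ∪ touching G B (touching G A B) ⊆ touching G B (A ∪ O) := by grind
    refine exchange (B := B) (hB.mono_root (by grind)) ?_ ?_ ?_ (by omega)
    · exact fun a ha => (mem_touching.1 ha).2
    · exact (disjoint_union_right.2 ⟨hAB, hAP⟩).mono_left touching_subset
    · grind
  have hbag : #(P ∪ touching G B O ∪ touching G A B ∪ touching G A O) ≤ n := by
    have := card_union_le (P ∪ touching G B O) (touching G A B)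
    have := card_union_le (P ∪ touching G B O ∪ touching G A B) (touching G A O)
    omega
  have hextended := hA.introduce hbag (by grind)
    (fun b hb s hs hbs => by
      have : s ∈ P ∨ s ∈ touching G A B := by grind [G.adj_comm]
      grind)
  have hjoin := (hextended.join hexchanged (by grind [Finset.disjoint_left])
    (by grind [Finset.disjoint_left]) (by grind)).mono_root
    (R₂ := P ∪ touching G (A ∪ B) O) (by grind)
  convert hjoin using 1
  grind

end HasRootedDecomp

section ChordDecomp

attribute [local grind =] mem_compl

variable {V : Type*} [LinearOrder V] [Fintype V] [LocallyFiniteOrder V]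
  (G : SimpleGraph V) [DecidableRel G.Adj]

/-- The edges of `G` that cross the chord with ends `x` and `y` when the vertices lie on a circle in
the order of `V`, each as a pair whose first component lies strictly between `x` and `y`. -/
def chordCrossings (x y : V) : Finset (V × V) :=
  G.interedges (Ioo (x ⊓ y) (x ⊔ y)) (uIcc x y)ᶜ

/-- The root bag used for the vertices from `u` to `v`: the ends of the chord together with the
vertices strictly between them that have a neighbour on the other side of the chord. -/
def chordBag (u v : V) : Finset V :=
  {u, v} ∪ touching G (Ioo u v) (Icc u v)ᶜ

/-- The chord with ends `u` and `v` is a side of a triangle whose third vertex lies strictly between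
them and whose other two sides are crossed by at most `m` edges of `G` each. -/
def HasSplit (m : ℕ) (u v : V) : Prop :=
  ∃ t ∈ Ioo u v, #(chordCrossings G u t) ≤ m ∧ #(chordCrossings G t v) ≤ m

variable {G} {m n : ℕ} {a b u v w x y : V}

@[grind =]
lemma mem_chordCrossings : (a, b) ∈ chordCrossings G x y ↔
    (x < a ∧ a < y ∨ y < a ∧ a < x) ∧ (b < x ∧ b < y ∨ x < b ∧ y < b) ∧ G.Adj a b := by
  rcases le_total x y with h | h <;>
    simp only [chordCrossings, SimpleGraph.mk_mem_interedges_iff, mem_compl, mem_uIcc, mem_Ioo, h,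
      inf_of_le_left, inf_of_le_right, sup_of_le_left, sup_of_le_right] <;>
    grind

lemma chordCrossings_comm (x y : V) : chordCrossings G x y = chordCrossings G y x := by
  rw [chordCrossings, chordCrossings, inf_comm, sup_comm, uIcc_comm]

lemma chordCrossings_of_le (huv : u ≤ v) :
    chordCrossings G u v = G.interedges (Ioo u v) (Icc u v)ᶜ := by
  rw [chordCrossings, inf_eq_left.2 huv, sup_eq_right.2 huv, uIcc_of_le huv]

lemma card_chordBag_le (huv : u ≤ v) : #(chordBag G u v) ≤ #(chordCrossings G u v) + 2 := by
  have := card_union_le {u, v} (touching G (Ioo u v) (Icc u v)ᶜ)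
  have := card_touching_le_card_interedges (G := G) (Ioo u v) (Icc u v)ᶜ
  have := card_le_two (a := u) (b := v)
  rw [chordBag, chordCrossings_of_le huv]
  omega

lemma HasRootedDecomp.introduce_corner (h : HasRootedDecomp G n (Icc u w) (chordBag G u w))
    (huw : u ≤ w) (hx : x ∉ Icc u w) (hn : #(chordCrossings G u w) + 3 ≤ n) :
    HasRootedDecomp G n (insert x (Icc u w)) (insert x (chordBag G u w)) := by
  have hsub := h.root_subset
  have hcard := (card_insert_le x (chordBag G u w)).trans
    (Nat.add_le_add_right (card_chordBag_le huw) 1)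
  have hnew : insert x (chordBag G u w) ∪ Icc u w = insert x (Icc u w) := by grind
  refine hnew ▸ h.introduce (hcard.trans hn) (by grind) fun b hb s hs hbs => ?_
  obtain rfl : b = x := by grind
  have hs' : s = u ∨ s = w ∨ s ∈ touching G (Ioo u w) (Icc u w)ᶜ := by grind [G.adj_comm]
  grind [chordBag]

/- Every edge between two of the sets cut off by the sides of the triangle crosses exactly two of
the sides. -/
lemma two_mul_card_interedges_le (huw : u < w) (hwv : w < v)
    (hcuv : #(chordCrossings G u v) ≤ m) (hcuw : #(chordCrossings G u w) ≤ m)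
    (hcwv : #(chordCrossings G w v) ≤ m) :
    2 * (#(G.interedges (Ioo u w) (Ioo w v)) + #(G.interedges (Ioo u w) (Icc u v)ᶜ) +
      #(G.interedges (Ioo w v) (Icc u v)ᶜ)) ≤ 3 * m := by
  rw [chordCrossings_of_le (by order)] at hcuv hcuw hcwv
  have huvO : #(G.interedges (Ioo u w ∪ Ioo w v) (Icc u v)ᶜ) ≤ m :=
    (card_interedges_mono (by grind) subset_rfl).trans hcuv
  have huwO : #(G.interedges (Ioo u w) (Ioo w v ∪ (Icc u v)ᶜ)) ≤ m :=
    (card_interedges_mono subset_rfl (by grind)).trans hcuw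
  have hwvO : #(G.interedges (Ioo w v) (Ioo u w ∪ (Icc u v)ᶜ)) ≤ m :=
    (card_interedges_mono subset_rfl (by grind)).trans hcwv
  rw [card_interedges_union_left (by grind [Finset.disjoint_left])] at huvO
  rw [card_interedges_union_right _ (by grind [Finset.disjoint_left])] at huwO hwvO
  rw [card_interedges_comm (Ioo w v) (Ioo u w)] at hwvO
  omega

lemma hasRootedDecomp_triangle (huw : u < w) (hwv : w < v) (hmn : 3 * m + 7 ≤ 2 * n)
    (hcuv : #(chordCrossings G u v) ≤ m) (hcuw : #(chordCrossings G u w) ≤ m)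
    (hcwv : #(chordCrossings G w v) ≤ m)
    (huw_decomp : HasRootedDecomp G n (Icc u w) (chordBag G u w))
    (hwv_decomp : HasRootedDecomp G n (Icc w v) (chordBag G w v)) :
    HasRootedDecomp G n (Icc u v) (chordBag G u v) := by
  have hcount := two_mul_card_interedges_le huw hwv hcuv hcuw hcwv
  have hcorners : #{u, w, v} ≤ 3 := card_le_three
  have hleft : HasRootedDecomp G n (Ioo u w ∪ {u, w, v})
      ({u, w, v} ∪ touching G (Ioo u w) (Ioo w v ∪ (Icc u v)ᶜ)) := by
    have hset : Ioo u w ∪ {u, w, v} = insert v (Icc u w) := by grind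
    exact hset ▸ (huw_decomp.introduce_corner huw.le (by grind) (by omega)).mono_root
      (by grind [chordBag])
  have hright : HasRootedDecomp G n (Ioo w v ∪ {u, w, v})
      ({u, w, v} ∪ touching G (Ioo w v) (Ioo u w ∪ (Icc u v)ᶜ)) := by
    have hset : Ioo w v ∪ {u, w, v} = insert u (Icc w v) := by grind
    exact hset ▸ (hwv_decomp.introduce_corner hwv.le (by grind) (by omega)).mono_root
      (by grind [chordBag])
  have hset : Ioo u w ∪ Ioo w v ∪ {u, w, v} = Icc u v := by grind
  exact hset ▸ (hleft.merge hright (by grind [Finset.disjoint_left])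
    (by grind [Finset.disjoint_left]) (by omega)).mono_root (by grind [chordBag])

lemma hasRootedDecomp_Icc (hmn : 3 * m + 7 ≤ 2 * n)
    (hsplit : ∀ u v, #(chordCrossings G u v) ≤ m → (Ioo u v).Nonempty → HasSplit G m u v)
    (huv : u ≤ v) (hc : #(chordCrossings G u v) ≤ m) :
    HasRootedDecomp G n (Icc u v) (chordBag G u v) := by
  induction hI : Ioo u v using Finset.strongInduction generalizing u v with
  | H I ih =>
    subst hI
    rcases (Ioo u v).eq_empty_or_nonempty with hempty | hne
    · have hbag : #(chordBag G u v) ≤ n := (card_chordBag_le huv).trans (by omega)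
      have hIcc : Icc u v = chordBag G u v := by grind [chordBag]
      rw [hIcc]
      exact HasRootedDecomp.of_card_le hbag
    · obtain ⟨t, ht, hcut, hctv⟩ := hsplit u v hc hne
      have hleft : Ioo u t ⊂ Ioo u v := (ssubset_iff_of_subset (by grind)).2 ⟨t, ht, by simp⟩
      have hright : Ioo t v ⊂ Ioo u v := (ssubset_iff_of_subset (by grind)).2 ⟨t, ht, by simp⟩
      rw [mem_Ioo] at ht
      exact hasRootedDecomp_triangle ht.1 ht.2 hmn hc hcut hctv
        (ih _ hleft ht.1.le hcut rfl) (ih _ hright ht.2.le hctv rfl)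

lemma treewidth_le_of_forall_split (hmn : 3 * m + 5 ≤ 2 * n)
    (hsplit : ∀ u v, #(chordCrossings G u v) ≤ m → (Ioo u v).Nonempty → HasSplit G m u v) :
    treewidth G ≤ (n : ℕ∞) := by
  rcases isEmpty_or_nonempty V with hV | hV
  · refine (HasRootedDecomp.of_card_le ?_).treewidth_le
    simp
  obtain ⟨u, hu⟩ : ∃ u : V, ∀ x, u ≤ x := Finite.exists_min id
  obtain ⟨v, hv⟩ : ∃ v : V, ∀ x, x ≤ v := Finite.exists_max id
  have huniv : Icc u v = univ := by grind
  have hc : chordCrossings G u v = ∅ := by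
    rw [chordCrossings_of_le (hu v), huniv, compl_univ]
    simp [SimpleGraph.interedges, Rel.interedges]
  have h := hasRootedDecomp_Icc (G := G) (n := n + 1) (by omega) hsplit (hu v) (by simp [hc])
  exact (huniv ▸ h).treewidth_le

end ChordDecomp

lemma exists_median {α ι : Type*} [LinearOrder ι] {s : Finset α} (hs : s.Nonempty) (f : α → ι) :
    ∃ p ∈ s, 2 * #{q ∈ s | f q < f p} ≤ #s ∧ 2 * #{q ∈ s | f p < f q} ≤ #s := by
  classical
  have hupper : ({p ∈ s | 2 * #{q ∈ s | f p < f q} ≤ #s}).Nonempty := by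
    obtain ⟨p, hp, hmax⟩ := s.exists_max_image f hs
    exact ⟨p, mem_filter.2 ⟨hp, by simp [filter_false_of_mem fun q hq => (hmax q hq).not_gt]⟩⟩
  obtain ⟨p, hp, hmin⟩ := exists_min_image _ f hupper
  rw [mem_filter] at hp
  refine ⟨p, hp.1, ?_, hp.2⟩
  rcases ({q ∈ s | f q < f p}).eq_empty_or_nonempty with hempty | hne
  · simp [hempty]
  obtain ⟨q, hq, hmax⟩ := exists_max_image _ f hne
  have hqs : #s < 2 * #{r ∈ s | f q < f r} := by grind
  have hdisj : Disjoint {r ∈ s | f r < f p} {r ∈ s | f q < f r} := by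
    grind [Finset.disjoint_left]
  have hcard := card_le_card
    (union_subset (filter_subset (fun r => f r < f p) s) (filter_subset (fun r => f q < f r) s))
  rw [card_union_of_disjoint hdisj] at hcard
  omega

section Split

attribute [local grind =] mem_compl SimpleGraph.mk_mem_interedges_iff

variable {V : Type*} [LinearOrder V] [Fintype V] [LocallyFiniteOrder V]
  {G : SimpleGraph V} [DecidableRel G.Adj] {j k m : ℕ} {p q u v w x y z : V}

lemma card_chordCrossings_le_add {s : Finset (V × V)}
    (h : ∀ a b, (a, b) ∈ chordCrossings G x y → (a, b) ∉ s →
      (a, b) ∈ chordCrossings G p q ∨ (b, a) ∈ chordCrossings G p q) :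
    #(chordCrossings G x y) ≤ #(chordCrossings G p q) + #s := by
  suffices hcr : #(chordCrossings G x y \ s) ≤ #(chordCrossings G p q) by
    have := card_le_card_sdiff_add_card (s := chordCrossings G x y) (t := s)
    omega
  refine card_le_card_of_injOn
    (fun e => if e ∈ chordCrossings G p q then e else e.swap) (fun e he => ?_) ?_
  · grind
  · rintro ⟨a, b⟩ hab ⟨c, d⟩ hcd heq
    simp only [coe_sdiff, Set.mem_sdiff, mem_coe] at hab hcd
    grind

lemma exists_split_of_light (hx : x ∈ Ioo u v) (hy : y ∉ Ioc u v)
    (hyu : y = u → ∀ b ∈ Ioo x v, ¬ G.Adj u b) (hxy : #(chordCrossings G x y) ≤ k)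
    (hkj : k + j ≤ m) (hl : #(G.interedges (Ioo u x) (Icc u v)ᶜ) ≤ j)
    (hr : #(G.interedges (Ioo x v) (Icc u v)ᶜ) ≤ j) :
    HasSplit G m u v :=
  ⟨x, hx,
    (card_chordCrossings_le_add (p := x) (q := y) (by grind [G.adj_comm])).trans
      ((add_le_add hxy hl).trans hkj),
    (card_chordCrossings_le_add (p := x) (q := y) (by grind [G.adj_comm])).trans
      ((add_le_add hxy hr).trans hkj)⟩

lemma exists_split_of_outermost (hx : x ∈ Ioo w z) (huw : u ≤ w) (hzv : z ≤ v)
    (hne : u < w ∨ z < v) (hwz : #(chordCrossings G w z) ≤ k)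
    (hmax : ∀ a ∈ Icc u w, ∀ b ∈ Icc z v, u < a ∨ b < v → G.Adj a b → a = w ∧ b = z)
    (hkj : k + j ≤ m) (hl : #(G.interedges (Ioo u x) (Icc u v)ᶜ) ≤ j)
    (hr : #(G.interedges (Ioo x v) (Icc u v)ᶜ) ≤ j) :
    HasSplit G m u v := by
  have hcorner : ∃ t ∈ Ioo u v, t = w ∨ t = z := by
    rcases hne with huw | hzv
    · exact ⟨w, by grind, .inl rfl⟩
    · exact ⟨z, by grind, .inr rfl⟩
  obtain ⟨t, ht, htwz⟩ := hcorner
  refine ⟨t, ht, (card_chordCrossings_le_add fun a b _ _ => ?_).trans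
      ((add_le_add hwz hl).trans hkj),
    (card_chordCrossings_le_add fun a b _ _ => ?_).trans ((add_le_add hwz hr).trans hkj)⟩
  · grind [G.adj_comm]
  · have := hmax b
    grind [G.adj_comm]

lemma exists_split_of_straddling (hx : x ∈ Ioo u v)
    (hstraddling : ∀ w ∈ Ico u x, ∀ z ∈ Ioc x v, u < w ∨ z < v → G.Adj w z →
      #(chordCrossings G w z) ≤ k)
    (hkj : k + j ≤ m) (hl : #(G.interedges (Ioo u x) (Icc u v)ᶜ) ≤ j)
    (hr : #(G.interedges (Ioo x v) (Icc u v)ᶜ) ≤ j) :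
    HasSplit G m u v := by
  let S := {e ∈ Ico u x ×ˢ Ioc x v | (u < e.1 ∨ e.2 < v) ∧ G.Adj e.1 e.2}
  have hS : ∀ a b, (a, b) ∈ S ↔
      (a ∈ Ico u x ∧ b ∈ Ioc x v) ∧ (u < a ∨ b < v) ∧ G.Adj a b := by simp [S]
  rcases S.eq_empty_or_nonempty with hempty | hne
  · have hnone : ∀ a ∈ Ico u x, ∀ b ∈ Ioc x v, u < a ∨ b < v → ¬ G.Adj a b := by grind
    refine ⟨x, hx, (card_le_card ?_).trans (hl.trans (by omega)),
      (card_le_card ?_).trans (hr.trans (by omega))⟩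
    · rintro ⟨a, b⟩ hab
      grind
    · rintro ⟨a, b⟩ hab
      grind [G.adj_comm]
  · obtain ⟨⟨w, z⟩, hwz, hmax⟩ := S.exists_max_image (fun e => #(Icc e.1 e.2)) hne
    have hwz' := (hS w z).1 hwz
    refine exists_split_of_outermost (w := w) (z := z) (by grind) (by grind) (by grind) hwz'.2.1
      (hstraddling w hwz'.1.1 z hwz'.1.2 hwz'.2.1 hwz'.2.2) (fun a ha b hb hne hab => ?_) hkj hl hr
    rw [mem_Icc] at ha hb
    have hIcc : Icc w z = Icc a b :=
      eq_of_subset_of_card_le (Icc_subset_Icc ha.2 hb.1) (hmax (a, b) ((hS a b).2 (by grind)))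
    have haw : a ∈ Icc w z := hIcc ▸ (by grind)
    have hbz : b ∈ Icc w z := hIcc ▸ (by grind)
    grind

variable (G) in
/-- Whenever two edges of `G` cross in a drawing with the vertices on a circle in the order of `V`,
one of the two has at most `k` crossings. -/
def IsMinPlanarOrder (k : ℕ) : Prop :=
  ∀ a b c d, G.Adj a b → (c, d) ∈ chordCrossings G a b →
    #(chordCrossings G a b) ≤ k ∨ #(chordCrossings G c d) ≤ k

lemma IsMinPlanarOrder.card_chordCrossings_le (hG : IsMinPlanarOrder G k) (hxy : G.Adj x y)
    (hheavy : ¬ #(chordCrossings G x y) ≤ k)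
    (hwz : (w, z) ∈ chordCrossings G x y ∨ (z, w) ∈ chordCrossings G x y) :
    #(chordCrossings G w z) ≤ k := by
  rcases hwz with hwz | hzw
  · exact (hG x y w z hxy hwz).resolve_left hheavy
  · rw [chordCrossings_comm]
    exact (hG x y z w hxy hzw).resolve_left hheavy

lemma exists_split_of_nonempty (hG : IsMinPlanarOrder G k) (hkm : 2 * k ≤ m + 1) (huv : u ≤ v)
    (hc : #(chordCrossings G u v) ≤ m) (hne : (chordCrossings G u v).Nonempty) :
    HasSplit G m u v := by
  obtain ⟨⟨x, y⟩, hxy, hbelow, habove⟩ := exists_median hne Prod.fst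
  have hx : x ∈ Ioo u v := by grind
  have hkj : k + m / 2 ≤ m := by omega
  have hl : #(G.interedges (Ioo u x) (Icc u v)ᶜ) ≤ m / 2 :=
    have hsub : G.interedges (Ioo u x) (Icc u v)ᶜ ⊆ {e ∈ chordCrossings G u v | e.1 < x} := by grind
    (card_le_card hsub).trans (by dsimp only at hbelow habove; omega)
  have hr : #(G.interedges (Ioo x v) (Icc u v)ᶜ) ≤ m / 2 :=
    have hsub : G.interedges (Ioo x v) (Icc u v)ᶜ ⊆ {e ∈ chordCrossings G u v | x < e.1} := by grind
    (card_le_card hsub).trans (by dsimp only at hbelow habove; omega)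
  by_cases hlight : #(chordCrossings G x y) ≤ k
  · exact exists_split_of_light hx (by grind) (by grind) hlight hkj hl hr
  · refine exists_split_of_straddling hx (fun w hw z hz _ hwz => ?_) hkj hl hr
    exact hG.card_chordCrossings_le (by grind) hlight (by grind [G.adj_comm])

lemma exists_split_of_eq_empty (hG : IsMinPlanarOrder G k) (hkm : k ≤ m)
    (hc : chordCrossings G u v = ∅) (hne : (Ioo u v).Nonempty) :
    HasSplit G m u v := by
  have hnone : ∀ a b, (a, b) ∉ chordCrossings G u v := by simp [hc]
  have hout : ∀ A ⊆ Ioo u v, #(G.interedges A (Icc u v)ᶜ) ≤ 0 := fun A hA => by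
    simp only [nonpos_iff_eq_zero, card_eq_zero, eq_empty_iff_forall_notMem, Prod.forall]
    grind
  have hcandidate : ({b ∈ Ioo u v | G.Adj u b ∨ Ioo u b = ∅}).Nonempty := by
    obtain ⟨b, hb, hmin⟩ := exists_min_image _ id hne
    have hgap : Ioo u b = ∅ := eq_empty_of_forall_notMem fun y hy =>
      (hmin y (by grind)).not_gt (mem_Ioo.1 hy).2
    exact ⟨b, mem_filter.2 ⟨hb, .inr hgap⟩⟩
  obtain ⟨x, hxc, hmax⟩ := exists_max_image _ id hcandidate
  obtain ⟨hx, hux⟩ := mem_filter.1 hxc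
  have hbeyond : ∀ b ∈ Ioo x v, ¬ G.Adj u b := fun b hb hub => by
    have := hmax b (by grind)
    grind
  have hl := hout (Ioo u x) (by grind)
  have hr := hout (Ioo x v) (by grind)
  by_cases hlight : #(chordCrossings G x u) ≤ k
  · exact exists_split_of_light hx (by grind) (fun _ => hbeyond) hlight hkm hl hr
  · have hadj : G.Adj u x := hux.resolve_right fun h => hlight <| by
      rw [chordCrossings_comm, chordCrossings_of_le (by grind), h]
      simp
    refine exists_split_of_straddling hx (fun w hw z hz _ hwz => ?_) hkm hl hr
    exact hG.card_chordCrossings_le hadj.symm hlight (by grind)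

lemma IsMinPlanarOrder.exists_split (hG : IsMinPlanarOrder G k) (hkm : 2 * k ≤ m + 1)
    (hc : #(chordCrossings G u v) ≤ m) (hne : (Ioo u v).Nonempty) :
    HasSplit G m u v := by
  rcases (chordCrossings G u v).eq_empty_or_nonempty with hempty | hcross
  · exact exists_split_of_eq_empty hG (by omega) hempty hne
  · exact exists_split_of_nonempty hG hkm (by grind [hne.exists_mem]) hc hcross

end Split

section Circle

lemma openSegment_inter_nonempty_of_smul_add_eq {E : Type*} [AddCommGroup E] [Module ℝ E]
    {p q s t : E} {α β γ δ : ℝ} (hα : 0 < α) (hβ : 0 < β) (hγ : 0 < γ) (hδ : 0 < δ)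
    (hsum : α + β = γ + δ) (h : α • p + β • s = γ • q + δ • t) :
    (openSegment ℝ p s ∩ openSegment ℝ q t).Nonempty := by
  refine ⟨(α + β)⁻¹ • (α • p + β • s), ⟨α / (α + β), β / (α + β), by positivity, by positivity,
    by field_simp, by module⟩, ⟨γ / (γ + δ), δ / (γ + δ), by positivity, by positivity,
    by field_simp, ?_⟩⟩
  rw [h, hsum]
  module

/-- The point with angle `θ` on the circle with centre `o` and radius `r`. -/
noncomputable def circlePoint (o : EuclideanSpace ℝ (Fin 2)) (r θ : ℝ) :
    EuclideanSpace ℝ (Fin 2) :=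
  o + r • !₂[Real.cos θ, Real.sin θ]

/-- Twice the signed area of the triangle spanned by three points of the unit circle, given by their
angles. -/
noncomputable def circleTriangleArea (a b c : ℝ) : ℝ :=
  Real.sin (b - a) + Real.sin (c - b) - Real.sin (c - a)

lemma sin_two_mul_add_sin_two_mul_sub (x y : ℝ) :
    Real.sin (2 * x) + Real.sin (2 * y) - Real.sin (2 * (x + y)) =
      4 * (Real.sin x * Real.sin y * Real.sin (x + y)) := by
  simp only [Real.sin_two_mul, Real.sin_add, Real.cos_add]
  linear_combination (-2 * Real.sin x * Real.cos x) * Real.sin_sq_add_cos_sq y -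
    2 * Real.sin y * Real.cos y * Real.sin_sq_add_cos_sq x

lemma circleTriangleArea_pos {a b c : ℝ} (hab : a < b) (hbc : b < c) (hca : c < a + 2 * Real.pi) :
    0 < circleTriangleArea a b c := by
  have hformula := sin_two_mul_add_sin_two_mul_sub ((b - a) / 2) ((c - b) / 2)
  have hhalf : (b - a) / 2 + (c - b) / 2 = (c - a) / 2 := by ring
  rw [hhalf, mul_div_cancel₀ _ two_ne_zero, mul_div_cancel₀ _ two_ne_zero,
    mul_div_cancel₀ _ two_ne_zero] at hformula
  have hb := Real.sin_pos_of_pos_of_lt_pi (x := (b - a) / 2) (by linarith) (by linarith)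
  have hc := Real.sin_pos_of_pos_of_lt_pi (x := (c - b) / 2) (by linarith) (by linarith)
  have ha := Real.sin_pos_of_pos_of_lt_pi (x := (c - a) / 2) (by linarith) (by linarith)
  rw [circleTriangleArea, hformula]
  positivity

lemma openSegment_circlePoint_inter_nonempty (o : EuclideanSpace ℝ (Fin 2)) (r : ℝ) {a b c d : ℝ}
    (hab : a < b) (hbc : b < c) (hcd : c < d) (hda : d < a + 2 * Real.pi) :
    (openSegment ℝ (circlePoint o r a) (circlePoint o r c) ∩
      openSegment ℝ (circlePoint o r b) (circlePoint o r d)).Nonempty := by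
  refine openSegment_inter_nonempty_of_smul_add_eq
    (circleTriangleArea_pos hbc hcd (by linarith))
    (circleTriangleArea_pos hab (hbc.trans hcd) hda)
    (circleTriangleArea_pos (hab.trans hbc) hcd hda)
    (circleTriangleArea_pos hab hbc (by linarith)) (by unfold circleTriangleArea; ring) ?_
  ext i
  fin_cases i <;> simp [circlePoint, circleTriangleArea, Real.sin_sub] <;> ring

end Circle

namespace ConvexDrawing

variable {V : Type*} (Γ : ConvexDrawing V)

/-- The angle, in `(-π, π]`, at which a vertex is placed on the circle. -/
noncomputable def angle (v : V) : ℝ :=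
  Complex.arg ⟨Γ.pos v 0 - Γ.center 0, Γ.pos v 1 - Γ.center 1⟩

lemma pos_eq_circlePoint (v : V) : Γ.pos v = circlePoint Γ.center Γ.radius (Γ.angle v) := by
  set z : ℂ := ⟨Γ.pos v 0 - Γ.center 0, Γ.pos v 1 - Γ.center 1⟩ with hz
  have hnorm : ‖z‖ = Γ.radius := by
    have h := Γ.pos_mem v
    rw [mem_sphere_iff_norm, EuclideanSpace.norm_eq, Fin.sum_univ_two] at h
    rw [← h, Complex.norm_def, Complex.normSq_apply]
    simp [z, sq]
  have hcos := Complex.norm_mul_cos_arg z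
  have hsin := Complex.norm_mul_sin_arg z
  rw [hnorm] at hcos hsin
  ext i
  fin_cases i <;> simp [circlePoint, angle, ← hz, hcos, hsin] <;> simp [z]

lemma angle_injective : Function.Injective Γ.angle := fun u v h =>
  Γ.pos_injective (by rw [pos_eq_circlePoint, pos_eq_circlePoint, h])

lemma angle_lt_angle_add_two_pi (u v : V) : Γ.angle v < Γ.angle u + 2 * Real.pi := by
  have hu : -Real.pi < Γ.angle u := Complex.neg_pi_lt_arg _
  have hv : Γ.angle v ≤ Real.pi := Complex.arg_le_pi _
  linarith

variable {Γ}

lemma Cross.symm {e f : Sym2 V} (h : Γ.Cross e f) : Γ.Cross f e :=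
  ⟨h.1.symm, Set.inter_comm _ _ ▸ h.2⟩

section Order

variable [LinearOrder V] {G : SimpleGraph V} {a b c d : V}

lemma cross_of_lt (hΓ : StrictMono Γ.angle) (hac : a < c) (hcb : c < b) (hbd : b < d) :
    Γ.Cross s(a, b) s(c, d) := by
  refine ⟨by grind, ?_⟩
  simp only [edgeInterior, Sym2.lift_mk, pos_eq_circlePoint]
  exact openSegment_circlePoint_inter_nonempty _ _ (hΓ hac) (hΓ hcb) (hΓ hbd)
    (Γ.angle_lt_angle_add_two_pi _ _)

variable [Fintype V] [LocallyFiniteOrder V] [DecidableRel G.Adj]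

lemma cross_of_mem_chordCrossings (hΓ : StrictMono Γ.angle) (h : (c, d) ∈ chordCrossings G a b) :
    Γ.Cross s(a, b) s(c, d) := by
  wlog hab : a ≤ b generalizing a b
  · rw [Sym2.eq_swap (a := a)]
    exact this (chordCrossings_comm (G := G) a b ▸ h) (by order)
  obtain ⟨⟨hac, hcb⟩, hd⟩ : (a < c ∧ c < b) ∧ (d < a ∨ b < d) := by grind
  rcases hd with hda | hbd
  · rw [Sym2.eq_swap (a := c)]
    exact (cross_of_lt hΓ hda hac hcb).symm
  · exact cross_of_lt hΓ hac hcb hbd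

lemma card_chordCrossings_le_crossings (hΓ : StrictMono Γ.angle) (a b : V) :
    (#(chordCrossings G a b) : ℕ∞) ≤ Γ.crossings G s(a, b) := by
  have hinj : Set.InjOn (fun e : V × V => s(e.1, e.2)) (chordCrossings G a b) := by
    rintro ⟨c, d⟩ hcd ⟨c', d'⟩ hcd' heq
    rw [mem_coe] at hcd hcd'
    grind
  rw [← Set.encard_coe_eq_coe_finsetCard, ← hinj.encard_image]
  refine Set.encard_le_encard ?_
  rintro _ ⟨⟨c, d⟩, hcd, rfl⟩
  exact ⟨(mem_chordCrossings.1 hcd).2.2, cross_of_mem_chordCrossings hΓ hcd⟩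

lemma isMinPlanarOrder {k : ℕ} (hΓ : StrictMono Γ.angle)
    (hG : ∀ e ∈ G.edgeSet, ∀ f ∈ G.edgeSet, Γ.Cross e f →
      Γ.crossings G e ≤ (k : ℕ∞) ∨ Γ.crossings G f ≤ (k : ℕ∞)) : IsMinPlanarOrder G k :=
  fun a b c d hab hcd => by
    have hlight := hG s(a, b) hab s(c, d) (mem_chordCrossings.1 hcd).2.2
      (cross_of_mem_chordCrossings hΓ hcd)
    exact_mod_cast hlight.imp (card_chordCrossings_le_crossings hΓ a b).trans
      (card_chordCrossings_le_crossings hΓ c d).trans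

end Order

end ConvexDrawing

end ConvexGraphDrawing

theorem mainTheorem4 {V : Type*} [Finite V] (G : SimpleGraph V) (k : ℕ) (hk : 1 ≤ k)
    (hG : ConvexGraphDrawing.IsOuterMinPlanar k G) :
    ConvexGraphDrawing.treewidth G ≤ ((3 * k + 1 : ℕ) : ℕ∞) := by
  classical
  obtain ⟨Γ, hΓ⟩ := hG
  let := LinearOrder.lift' Γ.angle Γ.angle_injective
  let := Fintype.ofFinite V
  let := Fintype.toLocallyFiniteOrder (α := V)
  have horder : ConvexGraphDrawing.IsMinPlanarOrder G k :=
    ConvexGraphDrawing.ConvexDrawing.isMinPlanarOrder (fun _ _ h => h) hΓ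
  exact ConvexGraphDrawing.treewidth_le_of_forall_split (m := 2 * k - 1) (by omega)
    fun u v hc hne => horder.exists_split (by omega) hc hne
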